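/- Let $(\mathcal X,d_{\mathcal X})$ be a compact metric space and $\omega$ a nonzero finite Borel measure on $\mathcal X$. A measurable map $F:\mathcal X\to\mathcal X$ is nonsingular if $\omega(E)=0$ implies $\omega(F^{-1}(E))=0$; $\mathcal K_F g=g\circ F$ denotes its Koopman operator on $L^2(\mathcal X,\omega)$, and $$\mathrm{Sp}_{\mathrm{ap}}(\mathcal K_F)=\{\lambda\in\mathbb C:\exists\, g_n\in L^2(\mathcal X,\omega),\ \|g_n\|=1,\ \lim_{n\to\infty}\|(\mathcal K_F-\lambda I)g_n\|=0\}.$$ For a nondecreasing continuous $\alpha:\mathbb R_{\ge0}\to\mathbb R_{\ge0}$ with $\alpha(0)=0$, let - $\Omega^{\alpha}_{\mathcal X}$ be the set of nonsingular $F$ with $\mathcal K_F$ bounded and $d_{\mathcal X}(F(x),F(y))\le\alpha(d_{\mathcal X}(x,y))$ for all $x,y\in\mathcal X$; - $\Omega^{m}_{\mathcal X}$ be the set of continuous $F$ that preserve $\omega$; - $\Omega_{\mathcal X}$ be the set of continuous nonsingular $F$ with $\mathcal K_F$ bounded. Snapshot data for $F$ is a family $y=(y_{x,n})_{x\in\mathcal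 X,n\in\mathbb N}$ in $\mathcal X$ with $d_{\mathcal X}(F(x),y_{x,n})\le 2^{-n}$ for all $x,n$. A (deterministic, general) algorithm for a class $\Omega$ of maps is a function $\Gamma$ that assigns to snapshot data of maps in $\Omega$ a nonempty compact subset of $\mathbb C$, such that to every input $y$ there belongs a nonempty finite set $Q(y)\subset\mathcal X\times\mathbb N$ with the following property: if $y'$ is another input with $y'_{x,n}=y_{x,n}$ for all $(x,n)\in Q(y)$, then $Q(y')=Q(y)$ and $\Gamma(y')=\Gamma(y)$. All limits below are in the Hausdorff metric on nonempty compact subsets of $\mathbb C$, and $B_r(0)\subset\mathbb C$ is the closed ball. For every $F$ in the classes above, $\mathrm{Sp}_{\mathrm{ap}}(\mathcal K_F)$ is a nonempty compact set, and the following hold. 1. (Two limits, $\Pi_2$.) For every such $\alpha$ there are algorithms $\Gamma_{n_2,n_1}$ ($n_1,n_2\in\mathbb N$) for $\Omega^\alpha_{\mathcal X}$ such that for all $F\in\Omega^\alpha_{\mathcal X}$ and all snapshot data $y$ for $F$ the limits $\Gamma_{n_2}(y)=\lim_{n_1\to\infty}\Gamma_{n_2,n_1}(y)$ exist, $\lim_{n_2\to\infty}\Gamma_{n_2}(y)=\mathrm{Sp}_{\mathrm{ap}}(\mathcal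 K_F)$, and $\mathrm{Sp}_{\mathrm{ap}}(\mathcal K_F)\subset\Gamma_{n_2}(y)+B_{2^{-n_2}}(0)$ for all $n_2$. 2. (Two limits, $\Sigma_2$.) There are algorithms $\Gamma_{n_2,n_1}$ for $\Omega^m_{\mathcal X}$ such that for all $F\in\Omega^m_{\mathcal X}$ and all snapshot data $y$ for $F$ the limits $\Gamma_{n_2}(y)=\lim_{n_1\to\infty}\Gamma_{n_2,n_1}(y)$ exist, $\lim_{n_2\to\infty}\Gamma_{n_2}(y)=\mathrm{Sp}_{\mathrm{ap}}(\mathcal K_F)$, and $\Gamma_{n_2}(y)\subset\mathrm{Sp}_{\mathrm{ap}}(\mathcal K_F)+B_{2^{-n_2}}(0)$ for all $n_2$. 3. (Three limits, $\Pi_3$.) There are algorithms $\Gamma_{n_3,n_2,n_1}$ for $\Omega_{\mathcal X}$ such that for all $F\in\Omega_{\mathcal X}$ and all snapshot data $y$ for $F$ the limits $\Gamma_{n_3,n_2}(y)=\lim_{n_1\to\infty}\Gamma_{n_3,n_2,n_1}(y)$ and $\Gamma_{n_3}(y)=\lim_{n_2\to\infty}\Gamma_{n_3,n_2}(y)$ exist,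 $\lim_{n_3\to\infty}\Gamma_{n_3}(y)=\mathrm{Sp}_{\mathrm{ap}}(\mathcal K_F)$, and $\mathrm{Sp}_{\mathrm{ap}}(\mathcal K_F)\subset\Gamma_{n_3}(y)+B_{2^{-n_3}}(0)$ for all $n_3$. -/

import Mathlib

open MeasureTheory Filter Topology TopologicalSpace
open scoped NNReal Pointwise

namespace KoopmanSCI

section Koopman

variable {X : Type*} [MeasurableSpace X]

/-- `K` is the Koopman operator of `F`: a bounded operator on `L²(X, ω)` acting by `g ↦ g ∘ F`. -/
def IsKoopman (F : X → X) (ω : Measure X) (K : Lp ℂ 2 ω →L[ℂ] Lp ℂ 2 ω) : Prop :=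
  ∀ g : Lp ℂ 2 ω, (K g : X → ℂ) =ᵐ[ω] (g : X → ℂ) ∘ F

/-- Composition with `F` is a bounded operator from `L²(X, ω)` to itself. -/
def KoopmanBounded (F : X → X) (ω : Measure X) : Prop :=
  ∃ K : Lp ℂ 2 ω →L[ℂ] Lp ℂ 2 ω, IsKoopman F ω K

open Classical in
/-- The Koopman operator of `F` on `L²(X, ω)` (with the value `0` if it is not bounded). -/
noncomputable def koopman (F : X → X) (ω : Measure X) : Lp ℂ 2 ω →L[ℂ] Lp ℂ 2 ω :=
  if h : KoopmanBounded F ω then h.choose else 0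

theorem koopman_spec {F : X → X} {ω : Measure X} (h : KoopmanBounded F ω) :
    IsKoopman F ω (koopman F ω) := by
  rw [koopman, dif_pos h]
  exact h.choose_spec

theorem IsKoopman.eq_koopman {F : X → X} {ω : Measure X} {K : Lp ℂ 2 ω →L[ℂ] Lp ℂ 2 ω}
    (hK : IsKoopman F ω K) : K = koopman F ω := by
  ext1 g
  exact Lp.ext ((hK g).trans (koopman_spec ⟨K, hK⟩ g).symm)

theorem koopmanBounded_of_measurePreserving {F : X → X} {ω : Measure X}
    (hF : MeasurePreserving F ω ω) : KoopmanBounded F ω :=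
  ⟨(Lp.compMeasurePreservingₗᵢ ℂ F hF).toContinuousLinearMap,
    fun g => Lp.coeFn_compMeasurePreserving g hF⟩

end Koopman

/-- The approximate point spectrum of a bounded operator. -/
def approxPointSpectrum {H : Type*} [NormedAddCommGroup H] [NormedSpace ℂ H]
    (K : H →L[ℂ] H) : Set ℂ :=
  {z | ∃ g : ℕ → H, (∀ n, ‖g n‖ = 1) ∧ Tendsto (fun n => ‖K (g n) - z • g n‖) atTop (𝓝 0)}

section Classes

variable {X : Type*} [MetricSpace X] [MeasurableSpace X]

/-- Continuous nonsingular maps with bounded Koopman operator. -/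
def ContinuousClass (ω : Measure X) : Set (X → X) :=
  {F | Continuous F ∧ Measure.QuasiMeasurePreserving F ω ω ∧ KoopmanBounded F ω}

/-- Nonsingular maps with modulus of continuity `α` and bounded Koopman operator. -/
def ModulusClass (ω : Measure X) (α : ℝ≥0 → ℝ≥0) : Set (X → X) :=
  {F | (∀ x y, nndist (F x) (F y) ≤ α (nndist x y)) ∧
    Measure.QuasiMeasurePreserving F ω ω ∧ KoopmanBounded F ω}

/-- Continuous measure-preserving maps. -/
def MeasurePreservingClass (ω : Measure X) : Set (X → X) :=
  {F | Continuous F ∧ MeasurePreserving F ω ω}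

end Classes

section Algorithms

variable {X : Type*} [MetricSpace X]

/-- `y` is snapshot data for `F` to arbitrary precision: `y x n` is a measurement of `F x` with
error at most `2⁻ⁿ`. -/
def IsSnapshotData (F : X → X) (y : X → ℕ → X) : Prop :=
  ∀ x n, dist (F x) (y x n) ≤ (1 / 2 : ℝ) ^ n

/-- All snapshot data of all maps in the class `Ω`: the inputs that an algorithm has to handle. -/
def snapshotInputs (Ω : Set (X → X)) : Set (X → ℕ → X) :=
  {y | ∃ F ∈ Ω, IsSnapshotData F y}

/-- `Γ` is a deterministic (general) algorithm on the snapshot data of the class `Ω`: on each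
input `y` it reads a nonempty finite set `Q y` of measurements, and on two inputs that agree on
the measurements read from the first of them it reads the same measurements and gives the same
output. -/
def IsGeneralAlgorithm {M : Type*} (Ω : Set (X → X)) (Γ : (X → ℕ → X) → M) : Prop :=
  ∃ Q : (X → ℕ → X) → Finset (X × ℕ), ∀ y ∈ snapshotInputs Ω, (Q y).Nonempty ∧
    ∀ y' ∈ snapshotInputs Ω, (∀ q ∈ Q y, y q.1 q.2 = y' q.1 q.2) → Q y = Q y' ∧ Γ y = Γ y'

end Algorithms

end KoopmanSCI

/-!
The closures of the approximate point pseudospectra at the thresholds `2⁻ᵐ` decrease to the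
approximate point spectrum, so it suffices to approximate them for one threshold at a time. Each
pseudospectrum is exhausted by a countable dense family of test pairs `(z, g)` with `g` continuous,
and the residual of a test pair is the limit of quadratures that use finitely many measurements.
An open condition on such limits can be decided in the same limit, by a search that eventually
stabilizes.

* For continuous maps this takes one limit for the residuals of finitely many test pairs, one for
  the pseudospectrum and one for the threshold.
* If the maps are equicontinuous, finitely many measurements determine the map uniformly up to a
  small error. A point of the pseudospectrum of `F` then lies in the pseudospectrum of every map
  compatible with the measurements, and the first two limits collapse into one.
* If `F` preserves `ω`, its Koopman operator is an isometry. It is unitary, hence normal, or its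
  spectrum contains `0` and, since the frontier of the spectrum consists of approximate
  eigenvalues, every ray from `0` meets the approximate point spectrum on the unit circle. In both
  cases a pair with residual less than `c` certifies an approximate eigenvalue within distance `c`,
  which gives the error control from inside.
-/

namespace KoopmanSCI

section Hausdorff

theorem tendsto_nonemptyCompacts_iff {α ι : Type*} [TopologicalSpace α] {l : Filter ι}
    {A : ι → NonemptyCompacts α} {S : NonemptyCompacts α} :
    Tendsto A l (𝓝 S) ↔
      (∀ U, IsOpen U → (S : Set α) ⊆ U → ∀ᶠ i in l, (A i : Set α) ⊆ U) ∧
      ∀ U, IsOpen U → ((S : Set α) ∩ U).Nonempty → ∀ᶠ i in l, ((A i : Set α) ∩ U).Nonempty := by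
  let := TopologicalSpace.vietoris α
  rw [nhds_induced, tendsto_comap_iff, TopologicalSpace.tendsto_nhds_generateFrom_iff]
  simp only [Set.mem_union, or_imp, forall_and, Set.forall_mem_image]
  rfl

theorem tendsto_nonemptyCompacts_of_subset_closure {α ι : Type*} [TopologicalSpace α]
    {l : Filter ι} {A : ι → NonemptyCompacts α} {S : NonemptyCompacts α} {D : Set α}
    (hD : (S : Set α) ⊆ closure D)
    (hupper : ∀ U, IsOpen U → (S : Set α) ⊆ U → ∀ᶠ i in l, (A i : Set α) ⊆ U)
    (hlower : ∀ z ∈ D, ∀ U, IsOpen U → z ∈ U → ∀ᶠ i in l, ((A i : Set α) ∩ U).Nonempty) :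
    Tendsto A l (𝓝 S) := by
  refine tendsto_nonemptyCompacts_iff.2 ⟨hupper, fun U hU ⟨z, hzS, hzU⟩ => ?_⟩
  obtain ⟨w, hwU, hwD⟩ := mem_closure_iff.1 (hD hzS) U hU hzU
  exact hlower w hwD U hU hwU

end Hausdorff

section Pseudospectrum

variable {H : Type*} [NormedAddCommGroup H] [NormedSpace ℂ H] {K : H →L[ℂ] H} {z : ℂ} {c d : ℝ}

/-- The `c`-approximate point pseudospectrum of `K`: the `z` that have a `c`-pseudoeigenvector.
The vector is not normalized, and the strict inequality forces it to be nonzero. -/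
def approxPseudospectrum (K : H →L[ℂ] H) (c : ℝ) : Set ℂ :=
  {z | ∃ g, ‖K g - z • g‖ < c * ‖g‖}

theorem approxPseudospectrum_mono (hcd : c ≤ d) :
    approxPseudospectrum K c ⊆ approxPseudospectrum K d := fun _ ⟨g, hg⟩ =>
  ⟨g, hg.trans_le (by gcongr)⟩

theorem pos_of_mem_approxPseudospectrum (hz : z ∈ approxPseudospectrum K c) : 0 < c := by
  obtain ⟨g, hg⟩ := hz
  exact pos_of_mul_pos_left ((norm_nonneg _).trans_lt hg) (norm_nonneg g)

theorem norm_lt_of_mem_approxPseudospectrum (hz : z ∈ approxPseudospectrum K c) :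
    ‖z‖ < ‖K‖ + c := by
  obtain ⟨g, hg⟩ := hz
  refine lt_of_mul_lt_mul_right ?_ (norm_nonneg g)
  calc ‖z‖ * ‖g‖ = ‖K g - (K g - z • g)‖ := by rw [sub_sub_cancel, norm_smul]
    _ ≤ ‖K g‖ + ‖K g - z • g‖ := norm_sub_le _ _
    _ < ‖K‖ * ‖g‖ + c * ‖g‖ := add_lt_add_of_le_of_lt (K.le_opNorm g) hg
    _ = (‖K‖ + c) * ‖g‖ := by ring

theorem isOpen_approxPseudospectrum : IsOpen (approxPseudospectrum K c) := by
  rw [approxPseudospectrum, Set.ofPred_exists]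
  exact isOpen_iUnion fun g => isOpen_lt (by fun_prop) continuous_const

theorem thickening_approxPseudospectrum_subset :
    Metric.thickening d (approxPseudospectrum K c) ⊆ approxPseudospectrum K (c + d) := by
  intro w hw
  obtain ⟨z, ⟨g, hg⟩, hwz⟩ := Metric.mem_thickening_iff.1 hw
  refine ⟨g, ?_⟩
  calc ‖K g - w • g‖ = ‖(K g - z • g) + (z - w) • g‖ := by congr 1; module
    _ ≤ ‖K g - z • g‖ + ‖(z - w) • g‖ := norm_add_le _ _
    _ < c * ‖g‖ + d * ‖g‖ := by
        rw [norm_smul, ← dist_eq_norm z w, dist_comm]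
        exact add_lt_add_of_lt_of_le hg (by gcongr)
    _ = (c + d) * ‖g‖ := by ring

theorem closure_approxPseudospectrum_subset (hcd : c < d) :
    closure (approxPseudospectrum K c) ⊆ approxPseudospectrum K d := by
  calc closure (approxPseudospectrum K c)
    _ ⊆ Metric.thickening (d - c) (approxPseudospectrum K c) :=
        Metric.closure_subset_thickening (sub_pos.2 hcd) _
    _ ⊆ approxPseudospectrum K d := by
        simpa only [add_sub_cancel] using
          thickening_approxPseudospectrum_subset (K := K) (c := c) (d := d - c)

theorem isCompact_closure_approxPseudospectrum (K : H →L[ℂ] H) (c : ℝ) :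
    IsCompact (closure (approxPseudospectrum K c)) := by
  refine Metric.isCompact_of_isClosed_isBounded isClosed_closure (Bornology.IsBounded.closure ?_)
  refine Metric.isBounded_closedBall.subset (t := Metric.closedBall 0 (‖K‖ + c)) fun z hz => ?_
  exact mem_closedBall_zero_iff.2 (norm_lt_of_mem_approxPseudospectrum hz).le

theorem mem_approxPointSpectrum_iff :
    z ∈ approxPointSpectrum K ↔ ∀ c > 0, z ∈ approxPseudospectrum K c := by
  constructor
  · rintro ⟨g, hg, hlim⟩ c hc
    obtain ⟨n, hn⟩ := (hlim.eventually_lt_const hc).exists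
    exact ⟨g n, by rwa [hg n, mul_one]⟩
  · intro h
    choose g hg using fun n : ℕ => h (1 / ((n : ℝ) + 1)) Nat.one_div_pos_of_nat
    have hne : ∀ n, ‖g n‖ ≠ 0 := fun n h0 => by
      simpa [h0, (norm_nonneg (K (g n) - z • g n)).not_gt] using hg n
    have hnormalize : ∀ n, ‖K ((‖g n‖⁻¹ : ℂ) • g n) - z • (‖g n‖⁻¹ : ℂ) • g n‖ ≤
        1 / ((n : ℝ) + 1) := fun n => by
      rw [map_smul, smul_comm z, ← smul_sub, norm_smul, norm_inv, Complex.norm_real, norm_norm,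
        inv_mul_le_iff₀ ((norm_nonneg _).lt_of_ne' (hne n)), mul_comm]
      exact (hg n).le
    refine ⟨fun n => (‖g n‖⁻¹ : ℂ) • g n, fun n => ?_, squeeze_zero (fun n => norm_nonneg _)
      hnormalize tendsto_one_div_add_atTop_nhds_zero_nat⟩
    rw [norm_smul, norm_inv, Complex.norm_real, norm_norm, inv_mul_cancel₀ (hne n)]

theorem approxPointSpectrum_subset_approxPseudospectrum (hc : 0 < c) :
    approxPointSpectrum K ⊆ approxPseudospectrum K c := fun _ hz =>
  mem_approxPointSpectrum_iff.1 hz c hc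

theorem iInter_closure_approxPseudospectrum {c : ℕ → ℝ} (hc : ∀ m, 0 < c m)
    (hc0 : Tendsto c atTop (𝓝 0)) :
    ⋂ m, closure (approxPseudospectrum K (c m)) = approxPointSpectrum K := by
  refine Set.Subset.antisymm (fun z hz => mem_approxPointSpectrum_iff.2 fun d hd => ?_)
    (Set.subset_iInter fun m =>
      (approxPointSpectrum_subset_approxPseudospectrum (hc m)).trans subset_closure)
  obtain ⟨m, hm⟩ := (hc0.eventually_lt_const hd).exists
  exact closure_approxPseudospectrum_subset hm (Set.mem_iInter.1 hz m)

theorem isCompact_approxPointSpectrum (K : H →L[ℂ] H) : IsCompact (approxPointSpectrum K) := by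
  rw [← iInter_closure_approxPseudospectrum (fun m => by positivity)
    (tendsto_pow_atTop_nhds_zero_of_lt_one one_half_pos.le one_half_lt_one)]
  exact (isCompact_closure_approxPseudospectrum K _).of_isClosed_subset
    (isClosed_iInter fun m => isClosed_closure) (Set.iInter_subset _ 0)

theorem eventually_closure_approxPseudospectrum_subset {c : ℕ → ℝ} (hc : ∀ m, 0 < c m)
    (hanti : Antitone c) (hc0 : Tendsto c atTop (𝓝 0)) {U : Set ℂ} (hU : IsOpen U)
    (hKU : approxPointSpectrum K ⊆ U) :
    ∀ᶠ m in atTop, closure (approxPseudospectrum K (c m)) ⊆ U := by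
  have hsub : Antitone fun m => closure (approxPseudospectrum K (c m)) := fun _ _ hmn =>
    closure_mono (approxPseudospectrum_mono (hanti hmn))
  obtain ⟨N, hN⟩ := exists_subset_nhds_of_isCompact' hsub.directed_ge
    (fun m => isCompact_closure_approxPseudospectrum K (c m)) (fun m => isClosed_closure)
    (U := U) (by
      rw [iInter_closure_approxPseudospectrum hc hc0]
      exact fun z hz => hU.mem_nhds (hKU hz))
  filter_upwards [eventually_ge_atTop N] with m hm using (hsub hm).trans hN

theorem tendsto_closure_approxPseudospectrum {c : ℕ → ℝ} (hc : ∀ m, 0 < c m)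
    (hanti : Antitone c) (hc0 : Tendsto c atTop (𝓝 0)) {S : NonemptyCompacts ℂ}
    (hS : (S : Set ℂ) = approxPointSpectrum K) {G : ℕ → NonemptyCompacts ℂ}
    (hG : ∀ m, (G m : Set ℂ) = closure (approxPseudospectrum K (c m))) :
    Tendsto G atTop (𝓝 S) := by
  refine tendsto_nonemptyCompacts_of_subset_closure subset_closure (fun U hU hSU => ?_)
    fun z hz U _ hzU => .of_forall fun m => ⟨z, ?_, hzU⟩
  · simpa only [hG] using eventually_closure_approxPseudospectrum_subset hc hanti hc0 hU (hS ▸ hSU)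
  · rw [hG]
    exact subset_closure (approxPointSpectrum_subset_approxPseudospectrum (hc m) (hS ▸ hz))

end Pseudospectrum

section BoundarySpectrum

variable {H : Type*} [NormedAddCommGroup H] [NormedSpace ℂ H] {K : H →L[ℂ] H} {z w : ℂ} {c : ℝ}

theorem notMem_approxPointSpectrum_iff :
    z ∉ approxPointSpectrum K ↔
      ∃ c > 0, ∀ g, c * ‖g‖ ≤ ‖(algebraMap ℂ (H →L[ℂ] H) z - K) g‖ := by
  simp [mem_approxPointSpectrum_iff, approxPseudospectrum, norm_sub_rev (z • _)]

theorem sub_dist_mul_norm_le {g : H}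
    (hg : c * ‖g‖ ≤ ‖(algebraMap ℂ (H →L[ℂ] H) z - K) g‖) :
    (c - dist z w) * ‖g‖ ≤ ‖(algebraMap ℂ (H →L[ℂ] H) w - K) g‖ := by
  have htriangle : ‖(algebraMap ℂ (H →L[ℂ] H) z - K) g‖ ≤
      ‖(algebraMap ℂ (H →L[ℂ] H) w - K) g‖ + ‖(z - w) • g‖ := by
    refine (congrArg norm ?_).trans_le (norm_add_le _ _)
    simp [sub_smul]
  rw [norm_smul, ← dist_eq_norm z w] at htriangle
  linarith

theorem isUnit_of_dist_lt_of_boundedBelow [CompleteSpace H] [Nontrivial H] {T S : H →L[ℂ] H}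
    (hT : IsUnit T) (hc : 0 < c) (hbelow : ∀ g, c * ‖g‖ ≤ ‖T g‖) (hST : dist S T < c) :
    IsUnit S := by
  obtain ⟨u, rfl⟩ := hT
  have hinv : ‖(↑u⁻¹ : H →L[ℂ] H)‖ ≤ c⁻¹ := by
    refine ContinuousLinearMap.opNorm_le_bound _ (by positivity) fun g => ?_
    rw [le_inv_mul_iff₀ hc]
    have hug : (u : H →L[ℂ] H) ((↑u⁻¹ : H →L[ℂ] H) g) = g :=
      congrArg (fun T : H →L[ℂ] H => T g) u.mul_inv
    simpa only [hug] using hbelow ((↑u⁻¹ : H →L[ℂ] H) g)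
  refine (u.ofNearby S ?_).isUnit
  rw [← dist_eq_norm]
  exact hST.trans_le ((le_inv_comm₀ (Units.norm_pos _) hc).1 hinv)

theorem frontier_spectrum_subset_approxPointSpectrum [CompleteSpace H] :
    frontier (spectrum ℂ K) ⊆ approxPointSpectrum K := by
  intro z hz
  by_contra hap
  obtain ⟨c, hc, hbelow⟩ := notMem_approxPointSpectrum_iff.1 hap
  have hzK : z ∈ spectrum ℂ K := (spectrum.isClosed K).frontier_subset hz
  rw [← frontier_compl] at hz
  obtain ⟨w, hw, hzw⟩ := Metric.mem_closure_iff.1 (frontier_subset_closure hz) (c / 2) (half_pos hc)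
  have : Nontrivial H := not_subsingleton_iff_nontrivial.1 fun _ => by
    simp [spectrum.of_subsingleton] at hzK
  refine hzK (isUnit_of_dist_lt_of_boundedBelow (spectrum.notMem_iff.1 hw)
    (sub_pos.2 (hzw.trans (half_lt_self hc))) (fun g => sub_dist_mul_norm_le (hbelow g)) ?_)
  rw [dist_sub_right, dist_eq_norm, ← map_sub, norm_algebraMap', ← dist_eq_norm]
  linarith

end BoundarySpectrum

section GrowthCondition

/-- Growth condition (G₁) for the approximate point spectrum: a `c`-pseudoeigenvalue lies at
distance less than `c` from it. This is what lets residuals certify an output from inside. -/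
def IsG1 {H : Type*} [NormedAddCommGroup H] [NormedSpace ℂ H] (K : H →L[ℂ] H) : Prop :=
  ∀ c, approxPseudospectrum K c ⊆ Metric.thickening c (approxPointSpectrum K)

section Isometry

variable {H : Type*} [NormedAddCommGroup H] [NormedSpace ℂ H] {K : H →L[ℂ] H} {z : ℂ} {c : ℝ}

theorem abs_one_sub_norm_lt_of_mem_approxPseudospectrum (hK : ∀ g, ‖K g‖ = ‖g‖)
    (hz : z ∈ approxPseudospectrum K c) : |1 - ‖z‖| < c := by
  obtain ⟨g, hg⟩ := hz
  refine lt_of_mul_lt_mul_right ?_ (norm_nonneg g)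
  calc |1 - ‖z‖| * ‖g‖ = |‖K g‖ - ‖z • g‖| := by
        rw [hK, norm_smul, ← one_sub_mul, abs_mul, abs_norm]
    _ ≤ ‖K g - z • g‖ := abs_norm_sub_norm_le _ _
    _ < c * ‖g‖ := hg

theorem norm_eq_one_of_mem_approxPointSpectrum (hK : ∀ g, ‖K g‖ = ‖g‖)
    (hz : z ∈ approxPointSpectrum K) : ‖z‖ = 1 := by
  have habs : |1 - ‖z‖| ≤ 0 := le_of_forall_pos_lt_add fun c hc => by
    simpa only [zero_add] using abs_one_sub_norm_lt_of_mem_approxPseudospectrum hK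
      (mem_approxPointSpectrum_iff.1 hz c hc)
  linarith [abs_nonpos_iff.1 habs]

theorem sphere_subset_approxPointSpectrum [CompleteSpace H] (hK : ∀ g, ‖K g‖ = ‖g‖)
    (hs : ¬ Function.Surjective K) : Metric.sphere 0 1 ⊆ approxPointSpectrum K := by
  intro z hz
  rw [mem_sphere_zero_iff_norm] at hz
  have hray : Continuous fun r : ℝ≥0 => (r : ℂ) * z := by fun_prop
  have hzero : 0 ∈ (fun r : ℝ≥0 => (r : ℂ) * z) ⁻¹' spectrum ℂ K := by
    have : ¬ IsUnit K := fun h => hs (ContinuousLinearMap.isUnit_iff_bijective.1 h).2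
    simpa [spectrum.zero_mem_iff] using this
  have htwo : 2 ∉ (fun r : ℝ≥0 => (r : ℂ) * z) ⁻¹' spectrum ℂ K := fun h => by
    have hnorm : ‖K‖ ≤ 1 := K.opNorm_le_bound zero_le_one fun g => by rw [hK, one_mul]
    have hle : ‖((2 : ℝ≥0) : ℂ) * z‖ ≤ ‖K‖ * ‖(1 : H →L[ℂ] H)‖ := spectrum.norm_le_norm_mul_of_mem h
    have hone : ‖K‖ * ‖(1 : H →L[ℂ] H)‖ ≤ 1 :=
      mul_le_one₀ hnorm (norm_nonneg _) ContinuousLinearMap.norm_id_le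
    norm_num [hz] at hle
    linarith
  obtain ⟨r, hr⟩ := nonempty_frontier_iff.2 ⟨⟨0, hzero⟩, fun h => htwo (h ▸ Set.mem_univ _)⟩
  have hap : (r : ℂ) * z ∈ approxPointSpectrum K :=
    frontier_spectrum_subset_approxPointSpectrum (hray.frontier_preimage_subset _ hr)
  have hr1 := norm_eq_one_of_mem_approxPointSpectrum hK hap
  have : r = 1 := by simpa [hz] using hr1
  simpa [this] using hap

end Isometry

section Normal

theorem norm_resolvent_le_of_isStarNormal {A : Type*} [CStarAlgebra A] {a : A} [IsStarNormal a]
    {z : ℂ} {c : ℝ} (hc : 0 < c) (hdist : ∀ w ∈ spectrum ℂ a, c ≤ dist z w) :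
    ‖resolvent a z‖ ≤ c⁻¹ := by
  have hne : ∀ w ∈ spectrum ℂ a, z - w ≠ 0 := fun w hw =>
    sub_ne_zero.2 (dist_pos.1 (hc.trans_le (hdist w hw)))
  have hresolvent : resolvent a z = cfc (fun w => (z - w)⁻¹) a := by
    rw [cfc_inv _ a hne, cfc_sub (fun _ => z) (fun w => w) a, cfc_const z a, cfc_id' ℂ a, resolvent]
  rw [hresolvent]
  refine norm_cfc_le (by positivity) fun w hw => ?_
  rw [norm_inv, ← dist_eq_norm]
  exact inv_anti₀ hc (hdist w hw)

variable {H : Type*} [NormedAddCommGroup H] [InnerProductSpace ℂ H] [CompleteSpace H]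
  {K : H →L[ℂ] H} {z : ℂ} {c : ℝ}

theorem spectrum_subset_approxPointSpectrum_of_isStarNormal (hK : IsStarNormal K) :
    spectrum ℂ K ⊆ approxPointSpectrum K := by
  intro z
  contrapose
  intro hap
  obtain ⟨c, hc, hbelow⟩ := notMem_approxPointSpectrum_iff.1 hap
  rw [spectrum.notMem_iff]
  set T : H →L[ℂ] H := algebraMap ℂ (H →L[ℂ] H) z - K
  have hTn : IsStarNormal T := by
    constructor
    rw [star_sub, ← algebraMap_star_comm]
    exact (Algebra.commute_algebraMap_left _ _).sub_left
      ((Algebra.commute_algebraMap_right _ _).sub_right hK.star_comm_self)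
  have hanti : AntilipschitzWith c⁻¹.toNNReal T :=
    AddMonoidHomClass.antilipschitz_of_bound T fun g => by
      rw [Real.coe_toNNReal _ (by positivity), le_inv_mul_iff₀ hc]
      exact hbelow g
  rw [ContinuousLinearMap.isUnit_iff_bijective,
    ContinuousLinearMap.bijective_iff_dense_range_and_antilipschitz,
    Submodule.topologicalClosure_eq_top_iff, ContinuousLinearMap.IsStarNormal.orthogonal_range hTn]
  exact ⟨LinearMap.ker_eq_bot.2 hanti.injective, _, hanti⟩

theorem mul_norm_le_of_forall_spectrum_le_dist (hK : IsStarNormal K) (hc : 0 < c)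
    (hdist : ∀ w ∈ spectrum ℂ K, c ≤ dist z w) (g : H) : c * ‖g‖ ≤ ‖K g - z • g‖ := by
  have hz : z ∉ spectrum ℂ K := fun h => (hdist z h).not_gt (by rwa [dist_self])
  have hinv : resolvent K z * (algebraMap ℂ (H →L[ℂ] H) z - K) = 1 :=
    Ring.inverse_mul_cancel _ (spectrum.notMem_iff.1 hz)
  rw [← le_inv_mul_iff₀ hc, ← norm_sub_rev (z • g)]
  calc ‖g‖ = ‖(resolvent K z * (algebraMap ℂ (H →L[ℂ] H) z - K)) g‖ := by
        rw [hinv, one_apply_eq_self]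
    _ = ‖resolvent K z (z • g - K g)‖ := by simp
    _ ≤ c⁻¹ * ‖z • g - K g‖ :=
        ContinuousLinearMap.le_of_opNorm_le _ (norm_resolvent_le_of_isStarNormal hc hdist) _

theorem isG1_of_isStarNormal (hK : IsStarNormal K) : IsG1 K := by
  intro c z hz
  have hc := pos_of_mem_approxPseudospectrum hz
  obtain ⟨g, hg⟩ := hz
  have hnear : ∃ w ∈ spectrum ℂ K, dist z w < c := by
    by_contra! hdist
    exact hg.not_ge (mul_norm_le_of_forall_spectrum_le_dist hK hc hdist g)
  obtain ⟨w, hw, hzw⟩ := hnear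
  exact Metric.mem_thickening_iff.2
    ⟨w, spectrum_subset_approxPointSpectrum_of_isStarNormal hK hw, hzw⟩

theorem isStarNormal_of_isometry_of_surjective (hK : ∀ g, ‖K g‖ = ‖g‖)
    (hs : Function.Surjective K) : IsStarNormal K := by
  rw [ContinuousLinearMap.isStarNormal_iff_norm_eq_adjoint]
  intro v
  obtain ⟨w, rfl⟩ := hs v
  have hadj : K.adjoint (K w) = w := congrArg (fun T : H →L[ℂ] H => T w)
    ((ContinuousLinearMap.norm_map_iff_adjoint_comp_self K).1 hK)
  rw [hK, hadj, hK]

theorem isG1_of_isometry (hK : ∀ g, ‖K g‖ = ‖g‖) : IsG1 K := by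
  by_cases hs : Function.Surjective K
  · exact isG1_of_isStarNormal (isStarNormal_of_isometry_of_surjective hK hs)
  intro c z hz
  have habs := abs_one_sub_norm_lt_of_mem_approxPseudospectrum hK hz
  have hpolar : z - Complex.exp (z.arg * Complex.I) =
      (‖z‖ - 1 : ℝ) * Complex.exp (z.arg * Complex.I) := by
    rw [Complex.ofReal_sub, sub_mul, Complex.norm_mul_exp_arg_mul_I, Complex.ofReal_one, one_mul]
  refine Metric.mem_thickening_iff.2 ⟨Complex.exp (z.arg * Complex.I),
    sphere_subset_approxPointSpectrum hK hs
      (mem_sphere_zero_iff_norm.2 (Complex.norm_exp_ofReal_mul_I _)), ?_⟩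
  rwa [dist_eq_norm, hpolar, norm_mul, Complex.norm_exp_ofReal_mul_I, mul_one, Complex.norm_real,
    Real.norm_eq_abs, abs_sub_comm]

end Normal

end GrowthCondition

section LimitSelection

theorem eventually_sInf_forall_le_eq {R : ℕ → ℕ → Prop} (h : ∃ j, ∀ t, R j t) :
    ∃ j, (∀ t, R j t) ∧ ∀ᶠ n in atTop, sInf {j | ∀ t ≤ n, R j t} = j := by
  classical
  refine ⟨Nat.find h, Nat.find_spec h, ?_⟩
  have hrefuted : ∀ j ∈ Finset.range (Nat.find h), ∀ᶠ n in atTop, ¬ ∀ t ≤ n, R j t := by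
    intro j hj
    obtain ⟨t, ht⟩ := not_forall.1 (Nat.find_min h (Finset.mem_range.1 hj))
    filter_upwards [eventually_ge_atTop t] with n hn hall using ht (hall t hn)
  filter_upwards [(Finset.eventually_all _).2 hrefuted] with n hn
  have hmem : Nat.find h ∈ {j | ∀ t ≤ n, R j t} := fun t _ => Nat.find_spec h t
  exact le_antisymm (Nat.sInf_le hmem) <| not_lt.1 fun hlt =>
    hn _ (Finset.mem_range.2 hlt) (Nat.sInf_mem ⟨_, hmem⟩)

section Reads

variable {X M : Type*} [TopologicalSpace X] [SeparableSpace X] [Nonempty X] {k l : ℕ}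
  {Γ : (X → ℕ → X) → M}

/-- `Γ` depends only on the measurements of index at most `k` at the first `k + 1` points of the
dense sequence `denseSeq X`; a fixed finite set of measurements then suffices for all inputs. -/
def ReadsLevel (k : ℕ) (Γ : (X → ℕ → X) → M) : Prop :=
  ∀ y y', (∀ i ≤ k, ∀ j ≤ k, y (denseSeq X i) j = y' (denseSeq X i) j) → Γ y = Γ y'

theorem ReadsLevel.mono (hΓ : ReadsLevel k Γ) (hkl : k ≤ l) : ReadsLevel l Γ := fun y y' hy =>
  hΓ y y' fun i hi j hj => hy i (hi.trans hkl) j (hj.trans hkl)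

end Reads

theorem ReadsLevel.isGeneralAlgorithm {X M : Type*} [MetricSpace X] [SeparableSpace X] [Nonempty X]
    {k : ℕ} {Γ : (X → ℕ → X) → M} (hΓ : ReadsLevel k Γ) (Ω : Set (X → X)) :
    IsGeneralAlgorithm Ω Γ := by
  classical
  let Q := (Finset.Iic k ×ˢ Finset.Iic k).image (Prod.map (denseSeq X) id)
  have hQ : ∀ i ≤ k, ∀ j ≤ k, (denseSeq X i, j) ∈ Q := fun i hi j hj =>
    Finset.mem_image_of_mem (Prod.map (denseSeq X) id) (a := (i, j))
      (Finset.mk_mem_product (Finset.mem_Iic.2 hi) (Finset.mem_Iic.2 hj))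
  exact ⟨fun _ => Q, fun y _ => ⟨⟨_, hQ 0 k.zero_le 0 k.zero_le⟩, fun y' _ hyy' =>
    ⟨rfl, hΓ y y' fun i hi j hj => hyy' _ (hQ i hi j hj)⟩⟩⟩

variable {X : Type*} [MetricSpace X] [SeparableSpace X] [Nonempty X] {Ω : Set (X → X)}

/-- Algorithms converge on all snapshot data of every `F ∈ Ω` to a point with the property `P F`.
The point may depend on the data and not only on `F`. -/
def LimitSelectable {M : Type*} [TopologicalSpace M] (Ω : Set (X → X))
    (P : (X → X) → M → Prop) : Prop :=
  ∃ s : ℕ → (X → ℕ → X) → M, (∀ k, ReadsLevel k (s k)) ∧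
    ∀ F ∈ Ω, ∀ y, IsSnapshotData F y → ∃ a, P F a ∧ Tendsto (fun k => s k y) atTop (𝓝 a)

namespace LimitSelectable

theorem map {M N : Type*} [TopologicalSpace M] [TopologicalSpace N] {P : (X → X) → M → Prop}
    {Q : (X → X) → N → Prop} (h : LimitSelectable Ω P) {f : M → N} (hf : Continuous f)
    (hPQ : ∀ F ∈ Ω, ∀ a, P F a → Q F (f a)) : LimitSelectable Ω Q := by
  obtain ⟨s, hs, hlim⟩ := h
  refine ⟨fun k y => f (s k y), fun k y y' hy => congrArg f (hs k y y' hy), fun F hF y hy => ?_⟩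
  obtain ⟨a, ha, hsa⟩ := hlim F hF y hy
  exact ⟨f a, hPQ F hF a ha, (hf.tendsto a).comp hsa⟩

theorem pi {J : Type*} {M : J → Type*} [∀ j, TopologicalSpace (M j)]
    {P : ∀ j, (X → X) → M j → Prop} (h : ∀ j, LimitSelectable Ω (P j)) :
    LimitSelectable Ω fun F (v : ∀ j, M j) => ∀ j, P j F (v j) := by
  choose s hs hlim using h
  refine ⟨fun k y j => s j k y, fun k y y' hy => funext fun j => hs j k y y' hy,
    fun F hF y hy => ?_⟩
  choose v hv hsv using fun j => hlim j F hF y hy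
  exact ⟨v, hv, tendsto_pi_nhds.2 hsv⟩

-- Membership of the limit in `U i` is refutable only after fixing an index `N` from which the
-- approximations lie in `U i`, so the search runs over the pairs `(i, N)`.
theorem select {V ι : Type*} [TopologicalSpace V] [TopologicalSpace ι] [Countable ι] [Nonempty ι]
    {ρ : (X → X) → V} (h : LimitSelectable Ω fun F v => v = ρ F) {U : ι → Set V}
    (hU : ∀ i, IsOpen (U i)) (hex : ∀ F ∈ Ω, ∃ i, ρ F ∈ U i) :
    LimitSelectable Ω fun F i => ρ F ∈ closure (U i) := by
  obtain ⟨s, hs, hlim⟩ := h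
  obtain ⟨e, he⟩ := exists_surjective_nat (ι × ℕ)
  let R (y : X → ℕ → X) (j t : ℕ) : Prop := (e j).2 ≤ t → s t y ∈ U (e j).1
  refine ⟨fun n y => (e (sInf {j | ∀ t ≤ n, R y j t})).1, fun n y y' hy => ?_, fun F hF y hy => ?_⟩
  · have hR : ∀ j, ∀ t ≤ n, R y j t ↔ R y' j t := fun j t ht => by
      simp only [R, (hs t).mono ht y y' hy]
    exact congrArg (fun A => (e (sInf A)).1) (Set.ext fun j => forall₂_congr (hR j))
  · obtain ⟨_, rfl, hsv⟩ := hlim F hF y hy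
    have hwitness : ∃ j, ∀ t, R y j t := by
      obtain ⟨i, hi⟩ := hex F hF
      obtain ⟨N, hN⟩ := eventually_atTop.1 (hsv ((hU i).mem_nhds hi))
      obtain ⟨j, hj⟩ := he (i, N)
      exact ⟨j, fun t ht => by simp only [hj] at ht ⊢; exact hN t ht⟩
    obtain ⟨j, hj, hstable⟩ := eventually_sInf_forall_le_eq hwitness
    refine ⟨(e j).1, mem_closure_of_tendsto hsv (eventually_atTop.2 ⟨_, hj⟩), ?_⟩
    exact tendsto_nhds_of_eventually_eq (hstable.mono fun n hn => congrArg (fun j => (e j).1) hn)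

theorem exists_algorithms {J M : Type*} [TopologicalSpace M] {P : J → (X → X) → M → Prop}
    (h : ∀ j, LimitSelectable Ω (P j)) :
    ∃ Γ : J → ℕ → (X → ℕ → X) → M, (∀ j k, IsGeneralAlgorithm Ω (Γ j k)) ∧
      ∀ F ∈ Ω, ∀ y, IsSnapshotData F y →
        ∃ G : J → M, ∀ j, P j F (G j) ∧ Tendsto (fun k => Γ j k y) atTop (𝓝 (G j)) := by
  choose Γ hΓ hlim using h
  exact ⟨Γ, fun j k => (hΓ j k).isGeneralAlgorithm Ω,
    fun F hF y hy => Classical.skolem.1 fun j => hlim j F hF y hy⟩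

end LimitSelectable

end LimitSelection

section KoopmanNorms

theorem norm_koopman_of_measurePreserving {X : Type*} [MeasurableSpace X] {ω : Measure X}
    {F : X → X} (hF : MeasurePreserving F ω ω) (g : Lp ℂ 2 ω) : ‖koopman F ω g‖ = ‖g‖ := by
  have hK : IsKoopman F ω (Lp.compMeasurePreservingₗᵢ ℂ F hF).toContinuousLinearMap := fun g =>
    Lp.coeFn_compMeasurePreserving g hF
  rw [← hK.eq_koopman]
  exact (Lp.compMeasurePreservingₗᵢ ℂ F hF).norm_map g

theorem norm_eq_sqrt_integral {X : Type*} [MeasurableSpace X] {ω : Measure X} {f : Lp ℂ 2 ω}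
    {u : X → ℂ} (hu : f =ᵐ[ω] u) : ‖f‖ = √(∫ x, ‖u x‖ ^ 2 ∂ω) := by
  have hsq : ‖f‖ ^ 2 = ∫ x, ‖u x‖ ^ 2 ∂ω := by
    rw [← RCLike.ofReal_inj (K := ℂ), RCLike.ofReal_pow, ← inner_self_eq_norm_sq_to_K, L2.inner_def,
      ← integral_ofReal]
    refine integral_congr_ae ?_
    filter_upwards [hu] with x hx
    rw [hx, inner_self_eq_norm_sq_to_K, RCLike.ofReal_pow]
  rw [← hsq, Real.sqrt_sq (norm_nonneg _)]

variable {X : Type*} [MetricSpace X] [CompactSpace X] [MeasurableSpace X] [BorelSpace X]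
  {ω : Measure X} [IsFiniteMeasure ω] {F F' : X → X} {z : ℂ} {c ε : ℝ}

theorem koopman_toLp_ae (hF : Measure.QuasiMeasurePreserving F ω ω) (hb : KoopmanBounded F ω)
    (g : C(X, ℂ)) : koopman F ω (ContinuousMap.toLp 2 ω ℂ g) =ᵐ[ω] fun x => g (F x) :=
  (koopman_spec hb _).trans (hF.ae_eq_comp (ContinuousMap.coeFn_toLp ω g))

theorem koopman_sub_smul_toLp_ae (hF : Measure.QuasiMeasurePreserving F ω ω)
    (hb : KoopmanBounded F ω) (g : C(X, ℂ)) (z : ℂ) :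
    ↑(koopman F ω (ContinuousMap.toLp 2 ω ℂ g) - z • ContinuousMap.toLp 2 ω ℂ g)
      =ᵐ[ω] fun x => g (F x) - z * g x := by
  filter_upwards [koopman_toLp_ae hF hb g, ContinuousMap.coeFn_toLp (p := 2) (𝕜 := ℂ) ω g,
    Lp.coeFn_sub (koopman F ω (ContinuousMap.toLp 2 ω ℂ g)) (z • ContinuousMap.toLp 2 ω ℂ g),
    Lp.coeFn_smul z (ContinuousMap.toLp 2 ω ℂ g)] with x hKg hg hsub hsmul
  rw [hsub, Pi.sub_apply, hsmul, Pi.smul_apply, hKg, hg, smul_eq_mul]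

theorem toLp_one_ne_zero [NeZero ω] : ContinuousMap.toLp 2 ω ℂ (1 : C(X, ℂ)) ≠ 0 := by
  intro h
  have hone := ContinuousMap.coeFn_toLp (p := 2) (𝕜 := ℂ) ω (1 : C(X, ℂ))
  rw [h] at hone
  obtain ⟨x, hx1, hx0⟩ := (hone.and (Lp.coeFn_zero ℂ 2 ω)).exists
  exact one_ne_zero (hx1.symm.trans hx0)

theorem one_mem_approxPointSpectrum [NeZero ω] (hF : Measure.QuasiMeasurePreserving F ω ω)
    (hb : KoopmanBounded F ω) : (1 : ℂ) ∈ approxPointSpectrum (koopman F ω) := by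
  refine mem_approxPointSpectrum_iff.2 fun c hc => ⟨ContinuousMap.toLp 2 ω ℂ 1, ?_⟩
  rw [norm_eq_sqrt_integral (koopman_sub_smul_toLp_ae hF hb 1 1)]
  simpa using mul_pos hc (norm_pos_iff.2 toLp_one_ne_zero)

theorem norm_koopman_toLp_sub_le (hF : Measure.QuasiMeasurePreserving F ω ω)
    (hb : KoopmanBounded F ω) (hF' : Measure.QuasiMeasurePreserving F' ω ω)
    (hb' : KoopmanBounded F' ω) (g : C(X, ℂ)) (hε : 0 ≤ ε)
    (hclose : ∀ x, dist (g (F' x)) (g (F x)) ≤ ε) :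
    ‖koopman F' ω (ContinuousMap.toLp 2 ω ℂ g) - koopman F ω (ContinuousMap.toLp 2 ω ℂ g)‖ ≤
      ω.real Set.univ ^ (ENNReal.toReal 2)⁻¹ * ε := by
  refine Lp.norm_le_of_ae_bound hε ?_
  filter_upwards [koopman_toLp_ae hF hb g, koopman_toLp_ae hF' hb' g,
    Lp.coeFn_sub (koopman F' ω (ContinuousMap.toLp 2 ω ℂ g))
      (koopman F ω (ContinuousMap.toLp 2 ω ℂ g))] with x hx hx' hsub
  rw [hsub, Pi.sub_apply, hx, hx', ← dist_eq_norm]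
  exact hclose x

theorem exists_continuousMap_of_mem_approxPseudospectrum {K : Lp ℂ 2 ω →L[ℂ] Lp ℂ 2 ω}
    (hz : z ∈ approxPseudospectrum K c) :
    ∃ g : C(X, ℂ), ‖K (ContinuousMap.toLp 2 ω ℂ g) - z • ContinuousMap.toLp 2 ω ℂ g‖ <
      c * ‖ContinuousMap.toLp 2 ω ℂ g‖ := by
  have hopen : IsOpen {f | ‖K f - z • f‖ < c * ‖f‖} := isOpen_lt (by fun_prop) (by fun_prop)
  exact (ContinuousMap.toLp_denseRange (p := 2) ℂ ω ℂ ENNReal.ofNat_ne_top).exists_mem_open hopen hz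

theorem exists_dist_lt_imp_mem_approxPseudospectrum (hF : Measure.QuasiMeasurePreserving F ω ω)
    (hb : KoopmanBounded F ω) (hz : z ∈ approxPseudospectrum (koopman F ω) c) :
    ∃ δ > 0, ∀ F', Measure.QuasiMeasurePreserving F' ω ω → KoopmanBounded F' ω →
      (∀ x, dist (F' x) (F x) < δ) → z ∈ approxPseudospectrum (koopman F' ω) c := by
  obtain ⟨g, hg⟩ := exists_continuousMap_of_mem_approxPseudospectrum hz
  set f := ContinuousMap.toLp 2 ω ℂ g
  obtain ⟨ε, hε, hsmall⟩ := exists_pos_mul_lt (sub_pos.2 hg)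
    (ω.real Set.univ ^ (ENNReal.toReal 2)⁻¹)
  obtain ⟨δ, hδ, hunif⟩ := Metric.uniformContinuous_iff.1
    (CompactSpace.uniformContinuous_of_continuous g.continuous) ε hε
  refine ⟨δ, hδ, fun F' hF' hb' hclose => ⟨f, ?_⟩⟩
  have hdiff : ‖koopman F' ω f - koopman F ω f‖ < c * ‖f‖ - ‖koopman F ω f - z • f‖ :=
    (norm_koopman_toLp_sub_le hF hb hF' hb' g hε.le fun x => (hunif (hclose x)).le).trans_lt hsmall
  calc ‖koopman F' ω f - z • f‖
      ≤ ‖koopman F' ω f - koopman F ω f‖ + ‖koopman F ω f - z • f‖ :=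
        norm_sub_le_norm_sub_add_norm_sub _ _ _
    _ < c * ‖f‖ := lt_sub_iff_add_lt.1 hdiff

end KoopmanNorms

section Residual

variable {X : Type*} [MetricSpace X] [CompactSpace X] [MeasurableSpace X] [BorelSpace X]
  {ω : Measure X} [IsFiniteMeasure ω] {K : Lp ℂ 2 ω →L[ℂ] Lp ℂ 2 ω} {F : X → X} {z : ℂ} {c ε : ℝ}

/-- The relative residual `‖(K - z) g‖ / ‖g‖` of an approximate eigenpair `p = (z, g)`, with the
value `0` if `g` vanishes in `L²`. -/
noncomputable def residual (K : Lp ℂ 2 ω →L[ℂ] Lp ℂ 2 ω) (p : ℂ × C(X, ℂ)) : ℝ :=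
  ‖K (ContinuousMap.toLp 2 ω ℂ p.2) - p.1 • ContinuousMap.toLp 2 ω ℂ p.2‖ /
    ‖ContinuousMap.toLp 2 ω ℂ p.2‖

theorem residual_lt_iff {p : ℂ × C(X, ℂ)} (hp : ContinuousMap.toLp 2 ω ℂ p.2 ≠ 0) :
    residual K p < c ↔ ‖K (ContinuousMap.toLp 2 ω ℂ p.2) - p.1 • ContinuousMap.toLp 2 ω ℂ p.2‖ <
      c * ‖ContinuousMap.toLp 2 ω ℂ p.2‖ :=
  div_lt_iff₀ (norm_pos_iff.2 hp)

/-- The approximate eigenpairs `(z, g)` with `g` continuous and nonzero in `L²(X, ω)`. -/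
abbrev EigenpairCandidate (ω : Measure X) [IsFiniteMeasure ω] : Type _ :=
  {p : ℂ × C(X, ℂ) // ContinuousMap.toLp 2 ω ℂ p.2 ≠ 0}

instance [NeZero ω] : Nonempty (EigenpairCandidate ω) := ⟨⟨(0, 1), toLp_one_ne_zero⟩⟩

/-- A dense sequence of approximate eigenpairs: the candidates among which algorithms search. -/
noncomputable def testPair (ω : Measure X) [IsFiniteMeasure ω] [NeZero ω] (i : ℕ) : ℂ × C(X, ℂ) :=
  denseSeq (EigenpairCandidate ω) i

theorem testPair_mem_approxPseudospectrum [NeZero ω] {i : ℕ} (hi : residual K (testPair ω i) < c) :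
    (testPair ω i).1 ∈ approxPseudospectrum K c :=
  ⟨_, (residual_lt_iff (denseSeq (EigenpairCandidate ω) i).2).1 hi⟩

theorem exists_residual_testPair_lt [NeZero ω] (hz : z ∈ approxPseudospectrum K c) (hε : 0 < ε) :
    ∃ i, residual K (testPair ω i) < c ∧ dist z (testPair ω i).1 < ε := by
  obtain ⟨g, hg⟩ := exists_continuousMap_of_mem_approxPseudospectrum hz
  let T : C(X, ℂ) →L[ℂ] Lp ℂ 2 ω := ContinuousMap.toLp 2 ω ℂ
  have hg0 : T g ≠ 0 := fun h => by
    simp only [show ContinuousMap.toLp 2 ω ℂ g = 0 from h, map_zero, smul_zero, sub_zero, norm_zero,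
      mul_zero, lt_irrefl] at hg
  have hpair : Continuous fun p : EigenpairCandidate ω => K (T p.1.2) - p.1.1 • T p.1.2 := by
    fun_prop
  have hopen : IsOpen {p : EigenpairCandidate ω |
      ‖K (T p.1.2) - p.1.1 • T p.1.2‖ < c * ‖T p.1.2‖ ∧ dist z p.1.1 < ε} :=
    (isOpen_lt hpair.norm (by fun_prop)).and (isOpen_lt (by fun_prop) continuous_const)
  obtain ⟨i, hi, hzi⟩ := (denseRange_denseSeq (EigenpairCandidate ω)).exists_mem_open hopen
    ⟨⟨(z, g), hg0⟩, hg, by rwa [dist_self]⟩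
  exact ⟨i, (residual_lt_iff (denseSeq (EigenpairCandidate ω) i).2).2 hi, hzi⟩

section Quadrature

variable [Nonempty X] {y : X → ℕ → X} {Ω : Set (X → X)}

/-- The residual of `p` computed from the measurements of index `t` at the first `t + 1` points of
`denseSeq X`: the value `F x` is replaced by the measurement at the sample point nearest to `x`. -/
noncomputable def quadResidual (ω : Measure X) (p : ℂ × C(X, ℂ)) (t : ℕ) (y : X → ℕ → X) : ℝ :=
  √(∫ x, ‖p.2 (y (SimpleFunc.nearestPt (denseSeq X) t x) t) - p.1 * p.2 x‖ ^ 2 ∂ω) /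
    √(∫ x, ‖p.2 x‖ ^ 2 ∂ω)

theorem readsLevel_quadResidual (ω : Measure X) (p : ℂ × C(X, ℂ)) (t : ℕ) :
    ReadsLevel t (quadResidual ω p t) := by
  intro y y' hy
  have hsample : ∀ x, y (SimpleFunc.nearestPt (denseSeq X) t x) t =
      y' (SimpleFunc.nearestPt (denseSeq X) t x) t := fun x =>
    hy _ (SimpleFunc.nearestPtInd_le (denseSeq X) t x) t le_rfl
  simp only [quadResidual, hsample]

theorem tendsto_snapshot_nearestPt (hF : Continuous F) (hy : IsSnapshotData F y) (x : X) :
    Tendsto (fun t => y (SimpleFunc.nearestPt (denseSeq X) t x) t) atTop (𝓝 (F x)) :=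
  ((hF.tendsto x).comp (SimpleFunc.tendsto_nearestPt (denseRange_denseSeq X x))).congr_dist <|
    squeeze_zero (fun _ => dist_nonneg) (fun t => hy _ t)
      (tendsto_pow_atTop_nhds_zero_of_lt_one one_half_pos.le one_half_lt_one)

theorem tendsto_quadResidual (hF : F ∈ ContinuousClass ω) (hy : IsSnapshotData F y)
    (p : ℂ × C(X, ℂ)) :
    Tendsto (fun t => quadResidual ω p t y) atTop (𝓝 (residual (koopman F ω) p)) := by
  obtain ⟨hc, hq, hb⟩ := hF
  obtain ⟨z, g⟩ := p
  rw [residual, norm_eq_sqrt_integral (koopman_sub_smul_toLp_ae hq hb g z),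
    norm_eq_sqrt_integral (ContinuousMap.coeFn_toLp (p := 2) (𝕜 := ℂ) ω g)]
  refine Tendsto.div_const (Tendsto.sqrt ?_) _
  refine tendsto_integral_of_dominated_convergence (fun _ => (‖g‖ + ‖z‖ * ‖g‖) ^ 2)
    (fun t => ?_) (integrable_const _) (fun t => .of_forall fun x => ?_) (.of_forall fun x => ?_)
  · have hsample : Measurable fun x => y (SimpleFunc.nearestPt (denseSeq X) t x) t :=
      ((SimpleFunc.nearestPt (denseSeq X) t).map fun x => y x t).measurable
    exact (((g.continuous.measurable.comp hsample).sub
      (g.continuous.measurable.const_mul z)).norm.pow_const 2).aestronglyMeasurable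
  · rw [Real.norm_of_nonneg (by positivity)]
    gcongr
    refine (norm_sub_le _ _).trans ?_
    rw [norm_mul]
    gcongr <;> exact g.norm_coe_le_norm _
  · have hvalue := (g.continuous.tendsto _).comp (tendsto_snapshot_nearestPt hc hy x)
    exact (hvalue.sub_const _).norm.pow 2

theorem limitSelectable_residual [NeZero ω] (hΩ : Ω ⊆ ContinuousClass ω) :
    LimitSelectable Ω fun F v => v = fun i => residual (koopman F ω) (testPair ω i) := by
  have hcoord : ∀ i, LimitSelectable Ω fun F r => r = residual (koopman F ω) (testPair ω i) :=
    fun i => ⟨quadResidual ω (testPair ω i), readsLevel_quadResidual ω _,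
      fun F hF y hy => ⟨_, rfl, tendsto_quadResidual (hΩ hF) hy _⟩⟩
  exact (LimitSelectable.pi hcoord).map continuous_id fun F _ v hv => funext hv

end Quadrature

end Residual

section Targets

variable {X : Type*} [MetricSpace X] [MeasurableSpace X]

/-- The approximate point spectrum of the Koopman operator is computable on `Ω` in two limits, with
error control from above in the last limit: the class `Π₂` of the paper. -/
def IsPiTwo (ω : Measure X) (Ω : Set (X → X)) : Prop :=
  ∃ Γ : ℕ → ℕ → (X → ℕ → X) → NonemptyCompacts ℂ,
    (∀ n₂ n₁, IsGeneralAlgorithm Ω (Γ n₂ n₁)) ∧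
    ∀ F ∈ Ω, ∀ y, IsSnapshotData F y →
      ∃ (S : NonemptyCompacts ℂ) (G : ℕ → NonemptyCompacts ℂ),
        (S : Set ℂ) = approxPointSpectrum (koopman F ω) ∧
        (∀ n₂, Tendsto (fun n₁ => Γ n₂ n₁ y) atTop (𝓝 (G n₂))) ∧
        Tendsto G atTop (𝓝 S) ∧
        ∀ n₂, (S : Set ℂ) ⊆ (G n₂ : Set ℂ) + Metric.closedBall (0 : ℂ) ((1 / 2 : ℝ) ^ n₂)

/-- The approximate point spectrum of the Koopman operator is computable on `Ω` in two limits, with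
error control from below in the last limit: the class `Σ₂` of the paper. -/
def IsSigmaTwo (ω : Measure X) (Ω : Set (X → X)) : Prop :=
  ∃ Γ : ℕ → ℕ → (X → ℕ → X) → NonemptyCompacts ℂ,
    (∀ n₂ n₁, IsGeneralAlgorithm Ω (Γ n₂ n₁)) ∧
    ∀ F ∈ Ω, ∀ y, IsSnapshotData F y →
      ∃ (S : NonemptyCompacts ℂ) (G : ℕ → NonemptyCompacts ℂ),
        (S : Set ℂ) = approxPointSpectrum (koopman F ω) ∧
        (∀ n₂, Tendsto (fun n₁ => Γ n₂ n₁ y) atTop (𝓝 (G n₂))) ∧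
        Tendsto G atTop (𝓝 S) ∧
        ∀ n₂, (G n₂ : Set ℂ) ⊆ (S : Set ℂ) + Metric.closedBall (0 : ℂ) ((1 / 2 : ℝ) ^ n₂)

/-- The approximate point spectrum of the Koopman operator is computable on `Ω` in three limits,
with error control from above in the last limit: the class `Π₃` of the paper. -/
def IsPiThree (ω : Measure X) (Ω : Set (X → X)) : Prop :=
  ∃ Γ : ℕ → ℕ → ℕ → (X → ℕ → X) → NonemptyCompacts ℂ,
    (∀ n₃ n₂ n₁, IsGeneralAlgorithm Ω (Γ n₃ n₂ n₁)) ∧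
    ∀ F ∈ Ω, ∀ y, IsSnapshotData F y →
      ∃ (S : NonemptyCompacts ℂ) (G : ℕ → NonemptyCompacts ℂ) (G' : ℕ → ℕ → NonemptyCompacts ℂ),
        (S : Set ℂ) = approxPointSpectrum (koopman F ω) ∧
        (∀ n₃ n₂, Tendsto (fun n₁ => Γ n₃ n₂ n₁ y) atTop (𝓝 (G' n₃ n₂))) ∧
        (∀ n₃, Tendsto (fun n₂ => G' n₃ n₂) atTop (𝓝 (G n₃))) ∧
        Tendsto G atTop (𝓝 S) ∧
        ∀ n₃, (S : Set ℂ) ⊆ (G n₃ : Set ℂ) + Metric.closedBall (0 : ℂ) ((1 / 2 : ℝ) ^ n₃)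

/-- The compact set `A ∪ {1}`. Since `1` is an eigenvalue of every Koopman operator, adjoining it
makes an output nonempty without introducing an error. -/
def insertOne (A : Set ℂ) (hA : A.Finite) : NonemptyCompacts ℂ :=
  ⟨⟨insert 1 A, (hA.insert 1).isCompact⟩, Set.insert_nonempty 1 A⟩

end Targets

section PseudospectralLimit

variable {X : Type*} [MetricSpace X] [CompactSpace X] [MeasurableSpace X] [BorelSpace X]
  {ω : Measure X} [IsFiniteMeasure ω] [NeZero ω] {F : X → X} {Ω : Set (X → X)}

theorem exists_nonemptyCompacts_eq_approxPointSpectrum (hF : F ∈ ContinuousClass ω) :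
    ∃ S : NonemptyCompacts ℂ, (S : Set ℂ) = approxPointSpectrum (koopman F ω) :=
  ⟨⟨⟨_, isCompact_approxPointSpectrum _⟩, 1, one_mem_approxPointSpectrum hF.2.1 hF.2.2⟩, rfl⟩

theorem exists_nonemptyCompacts_eq_closure_approxPseudospectrum (hF : F ∈ ContinuousClass ω)
    {c : ℝ} (hc : 0 < c) :
    ∃ G : NonemptyCompacts ℂ, (G : Set ℂ) = closure (approxPseudospectrum (koopman F ω) c) :=
  ⟨⟨⟨_, isCompact_closure_approxPseudospectrum _ c⟩, 1, subset_closure <|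
    approxPointSpectrum_subset_approxPseudospectrum hc <|
      one_mem_approxPointSpectrum hF.2.1 hF.2.2⟩, rfl⟩

theorem exists_tendsto_closure_approxPseudospectrum (hF : F ∈ ContinuousClass ω)
    {G : ℕ → NonemptyCompacts ℂ}
    (hG : ∀ m, (G m : Set ℂ) = closure (approxPseudospectrum (koopman F ω) ((1 / 2) ^ m))) :
    ∃ S : NonemptyCompacts ℂ, (S : Set ℂ) = approxPointSpectrum (koopman F ω) ∧
      Tendsto G atTop (𝓝 S) ∧
      ∀ m, (S : Set ℂ) ⊆ (G m : Set ℂ) + Metric.closedBall (0 : ℂ) ((1 / 2 : ℝ) ^ m) := by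
  obtain ⟨S, hS⟩ := exists_nonemptyCompacts_eq_approxPointSpectrum hF
  refine ⟨S, hS, tendsto_closure_approxPseudospectrum (fun m => by positivity)
    (pow_right_anti₀ one_half_pos.le one_half_lt_one.le)
    (tendsto_pow_atTop_nhds_zero_of_lt_one one_half_pos.le one_half_lt_one) hS hG, fun m => ?_⟩
  have hSG : (S : Set ℂ) ⊆ G m := by
    rw [hS, hG]
    exact (approxPointSpectrum_subset_approxPseudospectrum (by positivity)).trans subset_closure
  exact hSG.trans (Set.subset_add_left _ (Metric.mem_closedBall_self (by positivity)))

theorem isPiTwo_of_limitSelectable [Nonempty X] (hΩ : Ω ⊆ ContinuousClass ω)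
    (h : ∀ m : ℕ, LimitSelectable Ω fun F (A : NonemptyCompacts ℂ) =>
      (A : Set ℂ) = closure (approxPseudospectrum (koopman F ω) ((1 / 2) ^ m))) :
    IsPiTwo ω Ω := by
  obtain ⟨Γ, hΓ, hlim⟩ := LimitSelectable.exists_algorithms h
  refine ⟨Γ, hΓ, fun F hF y hy => ?_⟩
  obtain ⟨G, hG⟩ := hlim F hF y hy
  obtain ⟨S, hS, hGS, hcover⟩ :=
    exists_tendsto_closure_approxPseudospectrum (hΩ hF) fun m => (hG m).1
  exact ⟨S, G, hS, fun m => (hG m).2, hGS, hcover⟩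

end PseudospectralLimit

section Equicontinuous

section ConsistentMaps

variable {X : Type*} [MetricSpace X] [SeparableSpace X] [Nonempty X] {Ω : Set (X → X)} {F : X → X}
  {y : X → ℕ → X} {δ : ℝ}

/-- The maps in `Ω` for which the measurements of index `k` at the first `k + 1` points of
`denseSeq X` are accurate to precision `2⁻ᵏ`. -/
def consistentMaps (Ω : Set (X → X)) (k : ℕ) (y : X → ℕ → X) : Set (X → X) :=
  {F ∈ Ω | ∀ i ≤ k, dist (F (denseSeq X i)) (y (denseSeq X i) k) ≤ (1 / 2) ^ k}

theorem readsLevel_consistentMaps (Ω : Set (X → X)) (k : ℕ) :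
    ReadsLevel k (consistentMaps Ω k) := fun y y' hy => by
  ext F
  refine and_congr_right fun _ => forall₂_congr fun i hi => ?_
  rw [hy i hi k le_rfl]

theorem mem_consistentMaps (hF : F ∈ Ω) (hy : IsSnapshotData F y) (k : ℕ) :
    F ∈ consistentMaps Ω k y := ⟨hF, fun _ _ => hy _ k⟩

theorem eventually_forall_exists_dist_denseSeq_lt [CompactSpace X] (hδ : 0 < δ) :
    ∀ᶠ k in atTop, ∀ x : X, ∃ i ≤ k, dist x (denseSeq X i) < δ := by
  let B (k : ℕ) : Set X := ⋃ i ≤ k, Metric.ball (denseSeq X i) δ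
  have hmono : Monotone B := fun k l hkl =>
    Set.biUnion_mono (Set.Iic_subset_Iic.2 hkl) fun _ _ => subset_rfl
  have hcover : Set.univ ⊆ ⋃ k, B k := fun x _ => by
    obtain ⟨i, hi⟩ := (denseRange_denseSeq X).exists_dist_lt x hδ
    exact Set.mem_iUnion.2 ⟨i, Set.mem_iUnion₂.2 ⟨i, le_refl i, hi⟩⟩
  obtain ⟨N, hN⟩ := isCompact_univ.elim_directed_cover B
    (fun k => isOpen_biUnion fun i _ => Metric.isOpen_ball) hcover hmono.directed_le
  filter_upwards [eventually_ge_atTop N] with k hk x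
  obtain ⟨i, hi, hxi⟩ := Set.mem_iUnion₂.1 (hN (Set.mem_univ x))
  exact ⟨i, hi.trans hk, hxi⟩

theorem eventually_consistentMaps_dist_lt [CompactSpace X]
    (hΩ : UniformEquicontinuous ((↑) : Ω → X → X)) (hF : F ∈ Ω) (hy : IsSnapshotData F y)
    (hδ : 0 < δ) : ∀ᶠ k in atTop, ∀ F' ∈ consistentMaps Ω k y, ∀ x, dist (F' x) (F x) < δ := by
  obtain ⟨η, hη, hequi⟩ := Metric.uniformEquicontinuous_iff.1 hΩ (δ / 4) (by positivity)
  have hprecise : ∀ᶠ k : ℕ in atTop, (1 / 2 : ℝ) ^ k < δ / 4 :=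
    (tendsto_pow_atTop_nhds_zero_of_lt_one one_half_pos.le one_half_lt_one).eventually_lt_const
      (by positivity)
  filter_upwards [hprecise, eventually_forall_exists_dist_denseSeq_lt (X := X) hη]
    with k hk hnet F' ⟨hF', hmeasured⟩ x
  obtain ⟨i, hi, hxi⟩ := hnet x
  set p := denseSeq X i
  calc dist (F' x) (F x)
    _ ≤ dist (F' x) (F' p) + dist (F' p) (F p) + dist (F p) (F x) := dist_triangle4 _ _ _ _
    _ ≤ dist (F' x) (F' p) + (dist (F' p) (y p k) + dist (F p) (y p k)) + dist (F p) (F x) := by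
        gcongr
        exact dist_triangle_right _ _ _
    _ < δ / 4 + (δ / 4 + δ / 4) + δ / 4 := by
        gcongr
        · exact hequi _ _ hxi ⟨F', hF'⟩
        · exact (hmeasured i hi).trans_lt hk
        · exact (hy p k).trans_lt hk
        · exact hequi _ _ (by rwa [dist_comm]) ⟨F, hF⟩
    _ = δ := by ring

end ConsistentMaps

variable {X : Type*} [MetricSpace X] [CompactSpace X] [MeasurableSpace X] [BorelSpace X]
  {ω : Measure X} [IsFiniteMeasure ω] [NeZero ω] {Ω : Set (X → X)}

theorem limitSelectable_closure_approxPseudospectrum [Nonempty X] (hΩ : Ω ⊆ ContinuousClass ω)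
    (hequi : UniformEquicontinuous ((↑) : Ω → X → X)) {c : ℝ} (hc : 0 < c) :
    LimitSelectable Ω fun F (A : NonemptyCompacts ℂ) =>
      (A : Set ℂ) = closure (approxPseudospectrum (koopman F ω) c) := by
  let I (k : ℕ) (y : X → ℕ → X) : Set ℕ :=
    {i | i ≤ k ∧ ∀ F' ∈ consistentMaps Ω k y, denseSeq ℂ i ∈ approxPseudospectrum (koopman F' ω) c}
  have hI : ∀ k y, (I k y).Finite := fun k y => (Set.finite_Iic k).subset fun i hi => hi.1
  refine ⟨fun k y => insertOne (denseSeq ℂ '' I k y) ((hI k y).image _), fun k y y' hy => ?_,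
    fun F hF y hy => ?_⟩
  · simp only [I, readsLevel_consistentMaps Ω k y y' hy]
  obtain ⟨-, hq, hb⟩ := hΩ hF
  obtain ⟨G, hG⟩ := exists_nonemptyCompacts_eq_closure_approxPseudospectrum (hΩ hF) hc
  have hone : 1 ∈ approxPseudospectrum (koopman F ω) c :=
    approxPointSpectrum_subset_approxPseudospectrum hc (one_mem_approxPointSpectrum hq hb)
  refine ⟨G, hG, tendsto_nonemptyCompacts_of_subset_closure hG.subset
    (fun U _ hGU => .of_forall fun k => ?_) fun z hz U hU hzU => ?_⟩
  · refine (Set.insert_subset hone ?_).trans (subset_closure.trans (hG ▸ hGU))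
    exact Set.image_subset_iff.2 fun i hi => hi.2 F (mem_consistentMaps hF hy k)
  · obtain ⟨i, hi, hiU⟩ := (denseRange_denseSeq ℂ).exists_mem_open
      (isOpen_approxPseudospectrum.inter hU) ⟨z, hz, hzU⟩
    obtain ⟨δ, hδ, hstable⟩ := exists_dist_lt_imp_mem_approxPseudospectrum hq hb hi
    filter_upwards [eventually_ge_atTop i, eventually_consistentMaps_dist_lt hequi hF hy hδ]
      with k hk hclose
    have hiI : i ∈ I k y := ⟨hk, fun F' hF' =>
      hstable F' (hΩ hF'.1).2.1 (hΩ hF'.1).2.2 (hclose F' hF')⟩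
    exact ⟨_, Set.mem_insert_of_mem 1 (Set.mem_image_of_mem _ hiI), hiU⟩

theorem isPiTwo_of_uniformEquicontinuous (hΩ : Ω ⊆ ContinuousClass ω)
    (hequi : UniformEquicontinuous ((↑) : Ω → X → X)) : IsPiTwo ω Ω := by
  have := Measure.nonempty_of_neZero ω
  exact isPiTwo_of_limitSelectable hΩ fun m =>
    limitSelectable_closure_approxPseudospectrum hΩ hequi (by positivity)

end Equicontinuous

section ThreeLimits

variable {X : Type*} [MetricSpace X] [CompactSpace X] [MeasurableSpace X] [BorelSpace X]
  {ω : Measure X} [IsFiniteMeasure ω] [NeZero ω] {Ω : Set (X → X)} {a b c : ℝ}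

-- Neither `residual < b` nor its negation can be confirmed in one limit; two open conditions that
-- overlap on `a < residual < b` leave room for a decision.
theorem limitSelectable_decide_residual [Nonempty X] (hΩ : Ω ⊆ ContinuousClass ω) (hab : a < b)
    (i : ℕ) : LimitSelectable Ω fun F (d : Bool) =>
      (d = true → residual (koopman F ω) (testPair ω i) < b) ∧
      (residual (koopman F ω) (testPair ω i) < a → d = true) := by
  obtain ⟨b', hab', hb'⟩ := exists_between hab
  let U (d : Bool) : Set (ℕ → ℝ) := cond d {v | v i < b'} {v | a < v i}
  have hU : ∀ d, IsOpen (U d) := by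
    rintro (_ | _)
    · exact isOpen_lt continuous_const (continuous_apply i)
    · exact isOpen_lt (continuous_apply i) continuous_const
  refine ((limitSelectable_residual hΩ).select hU fun F _ => ?_).map continuous_id
    fun F _ d hd => ?_
  · rcases lt_or_ge a (residual (koopman F ω) (testPair ω i)) with h | h
    · exact ⟨false, h⟩
    · exact ⟨true, h.trans_lt hab'⟩
  · rcases d with _ | _
    · have hle := closure_lt_subset_le continuous_const (continuous_apply i) hd
      exact ⟨fun h => by simp at h, fun h => absurd h (not_lt.2 hle)⟩
    · have hle := closure_lt_subset_le (continuous_apply i) continuous_const hd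
      exact ⟨fun _ => lt_of_le_of_lt hle hb', fun _ => rfl⟩

theorem limitSelectable_inner_approxPseudospectrum [Nonempty X] (hΩ : Ω ⊆ ContinuousClass ω)
    (hab : a < b) (hb : 0 < b) (s : Finset ℕ) :
    LimitSelectable Ω fun F (A : NonemptyCompacts ℂ) =>
      (A : Set ℂ) ⊆ approxPseudospectrum (koopman F ω) b ∧
      ∀ i ∈ s, residual (koopman F ω) (testPair ω i) < a → (testPair ω i).1 ∈ (A : Set ℂ) := by
  let accepted (d : s → Bool) : Set ℂ := (fun i : s => (testPair ω i).1) '' {i | d i = true}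
  refine (LimitSelectable.pi fun i : s => limitSelectable_decide_residual hΩ hab i).map
    (f := fun d => insertOne (accepted d) (Set.toFinite _)) continuous_of_discreteTopology
    fun F hF d hd => ⟨Set.insert_subset ?_ ?_, fun i hi hia => ?_⟩
  · exact approxPointSpectrum_subset_approxPseudospectrum hb
      (one_mem_approxPointSpectrum (hΩ hF).2.1 (hΩ hF).2.2)
  · rintro _ ⟨i, hi, rfl⟩
    exact testPair_mem_approxPseudospectrum ((hd i).1 hi)
  · exact Set.mem_insert_of_mem 1 ⟨⟨i, hi⟩, (hd ⟨i, hi⟩).2 hia, rfl⟩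

theorem tendsto_of_inner_approxPseudospectrum {K : Lp ℂ 2 ω →L[ℂ] Lp ℂ 2 ω} {a : ℕ → ℝ}
    (ha : Tendsto a atTop (𝓝 c)) {G : NonemptyCompacts ℂ}
    (hG : (G : Set ℂ) = closure (approxPseudospectrum K c)) {A : ℕ → NonemptyCompacts ℂ}
    (hAsub : ∀ n, (A n : Set ℂ) ⊆ approxPseudospectrum K c)
    (hAmem : ∀ n, ∀ i ∈ Finset.range n, residual K (testPair ω i) < a n →
      (testPair ω i).1 ∈ (A n : Set ℂ)) :
    Tendsto A atTop (𝓝 G) := by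
  refine tendsto_nonemptyCompacts_of_subset_closure hG.subset
    (fun U _ hGU => .of_forall fun n => ?_) fun z hz U hU hzU => ?_
  · exact (hAsub n).trans (subset_closure.trans (hG ▸ hGU))
  · obtain ⟨ε, hε, hball⟩ := Metric.isOpen_iff.1 hU z hzU
    obtain ⟨i, hi, hzi⟩ := exists_residual_testPair_lt hz hε
    filter_upwards [ha.eventually_const_lt hi, eventually_gt_atTop i] with n hn hin
    exact ⟨_, hAmem n i (Finset.mem_range.2 hin) hn, hball (Metric.mem_ball'.2 hzi)⟩

theorem isPiThree_of_subset_continuousClass (hΩ : Ω ⊆ ContinuousClass ω) : IsPiThree ω Ω := by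
  have := Measure.nonempty_of_neZero ω
  obtain ⟨Γ, hΓ, hlim⟩ := LimitSelectable.exists_algorithms fun j : ℕ × ℕ =>
    limitSelectable_inner_approxPseudospectrum hΩ
      (sub_lt_self ((1 / 2 : ℝ) ^ j.1) (Nat.one_div_pos_of_nat (n := j.2))) (by positivity)
      (Finset.range j.2)
  refine ⟨fun m n => Γ (m, n), fun m n => hΓ (m, n), fun F hF y hy => ?_⟩
  obtain ⟨G', hG'⟩ := hlim F hF y hy
  choose G hG using fun m : ℕ => exists_nonemptyCompacts_eq_closure_approxPseudospectrum (hΩ hF)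
    (c := (1 / 2 : ℝ) ^ m) (by positivity)
  obtain ⟨S, hS, hGS, hcover⟩ := exists_tendsto_closure_approxPseudospectrum (hΩ hF) hG
  refine ⟨S, G, fun m n => G' (m, n), hS, fun m n => (hG' (m, n)).2, fun m => ?_, hGS, hcover⟩
  have hthreshold : Tendsto (fun n : ℕ => (1 / 2 : ℝ) ^ m - 1 / ((n : ℝ) + 1)) atTop
      (𝓝 ((1 / 2) ^ m)) := by
    simpa only [sub_zero] using tendsto_one_div_add_atTop_nhds_zero_nat.const_sub ((1 / 2 : ℝ) ^ m)
  exact tendsto_of_inner_approxPseudospectrum hthreshold (hG m) (fun n => (hG' (m, n)).1.1)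
    fun n => (hG' (m, n)).1.2

end ThreeLimits

section GrowthConditionLimits

variable {X : Type*} [MetricSpace X] [CompactSpace X] [MeasurableSpace X] [BorelSpace X]
  {ω : Measure X} [IsFiniteMeasure ω] [NeZero ω] {Ω : Set (X → X)} {b ε : ℝ}

theorem exists_residual_testPair_lt_of_isG1 {K : Lp ℂ 2 ω →L[ℂ] Lp ℂ 2 ω} (hK : IsG1 K)
    (hb : 0 < b) (hε : 0 < ε) (i : ℕ) : ∃ j, residual K (testPair ω j) < b ∧
      dist (testPair ω i).1 (testPair ω j).1 < residual K (testPair ω i) + ε := by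
  obtain ⟨w, hw, hiw⟩ := Metric.mem_thickening_iff.1 <| hK _ <|
    testPair_mem_approxPseudospectrum
      (lt_add_of_pos_right (residual K (testPair ω i)) (half_pos hε))
  obtain ⟨j, hj, hwj⟩ := exists_residual_testPair_lt
    (approxPointSpectrum_subset_approxPseudospectrum hb hw) (half_pos hε)
  refine ⟨j, hj, (dist_triangle _ w _).trans_lt ?_⟩
  linarith

theorem limitSelectable_near_testPair [Nonempty X] (hΩ : Ω ⊆ ContinuousClass ω)
    (hG1 : ∀ F ∈ Ω, IsG1 (koopman F ω)) (hb : 0 < b) (hε : 0 < ε) (i : ℕ) :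
    LimitSelectable Ω fun F (j : ℕ) => residual (koopman F ω) (testPair ω j) < b ∧
      dist (testPair ω i).1 (testPair ω j).1 ≤ residual (koopman F ω) (testPair ω i) + ε := by
  let U (j : ℕ) : Set (ℕ → ℝ) :=
    {v | v j < b / 2} ∩ {v | dist (testPair ω i).1 (testPair ω j).1 < v i + ε}
  have hU : ∀ j, IsOpen (U j) := fun j =>
    (isOpen_lt (by fun_prop) (by fun_prop)).inter (isOpen_lt (by fun_prop) (by fun_prop))
  refine ((limitSelectable_residual hΩ).select hU fun F hF =>
    exists_residual_testPair_lt_of_isG1 (hG1 F hF) (half_pos hb) hε i).map continuous_id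
    fun F _ j hj => ?_
  obtain ⟨hres, hdist⟩ := closure_inter_subset_inter_closure _ _ hj
  have hres' := closure_lt_subset_le (by fun_prop) (by fun_prop) hres
  exact ⟨lt_of_le_of_lt hres' (half_lt_self hb),
    closure_lt_subset_le (by fun_prop) (by fun_prop) hdist⟩

theorem limitSelectable_net_of_isG1 [Nonempty X] (hΩ : Ω ⊆ ContinuousClass ω)
    (hG1 : ∀ F ∈ Ω, IsG1 (koopman F ω)) (hb : 0 < b) (hε : 0 < ε) (s : Finset ℕ) :
    LimitSelectable Ω fun F (A : NonemptyCompacts ℂ) =>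
      (A : Set ℂ) ⊆ approxPseudospectrum (koopman F ω) b ∧
      ∀ i ∈ s, ∃ z ∈ (A : Set ℂ),
        dist (testPair ω i).1 z ≤ residual (koopman F ω) (testPair ω i) + ε := by
  refine (LimitSelectable.pi fun i : s => limitSelectable_near_testPair hΩ hG1 hb hε i).map
    (f := fun j => insertOne (Set.range fun i => (testPair ω (j i)).1) (Set.finite_range _))
    continuous_of_discreteTopology fun F hF j hj => ⟨Set.insert_subset ?_ ?_, fun i hi => ?_⟩
  · exact approxPointSpectrum_subset_approxPseudospectrum hb
      (one_mem_approxPointSpectrum (hΩ hF).2.1 (hΩ hF).2.2)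
  · exact Set.range_subset_iff.2 fun i => testPair_mem_approxPseudospectrum (hj i).1
  · exact ⟨_, Set.mem_insert_of_mem 1 ⟨⟨i, hi⟩, rfl⟩, (hj ⟨i, hi⟩).2⟩

theorem tendsto_of_subset_thickening_of_net {K : Lp ℂ 2 ω →L[ℂ] Lp ℂ 2 ω} {ε : ℕ → ℝ}
    (hε : Tendsto ε atTop (𝓝 0)) {S : NonemptyCompacts ℂ}
    (hS : (S : Set ℂ) = approxPointSpectrum K) {A : ℕ → NonemptyCompacts ℂ}
    (hAsub : ∀ n, (A n : Set ℂ) ⊆ Metric.thickening (ε n) (S : Set ℂ))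
    (hAnet : ∀ n, ∀ i ∈ Finset.range n, ∃ z ∈ (A n : Set ℂ),
      dist (testPair ω i).1 z ≤ residual K (testPair ω i) + ε n) :
    Tendsto A atTop (𝓝 S) := by
  refine tendsto_nonemptyCompacts_of_subset_closure subset_closure (fun U hU hSU => ?_)
    fun z hz U hU hzU => ?_
  · obtain ⟨δ, hδ, hthick⟩ := S.isCompact.exists_thickening_subset_open hU hSU
    filter_upwards [hε.eventually_lt_const hδ] with n hn
    exact (hAsub n).trans ((Metric.thickening_mono hn.le _).trans hthick)
  · obtain ⟨δ, hδ, hball⟩ := Metric.isOpen_iff.1 hU z hzU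
    have hδ3 : 0 < δ / 3 := by positivity
    obtain ⟨i, hi, hzi⟩ := exists_residual_testPair_lt
      (approxPointSpectrum_subset_approxPseudospectrum hδ3 (hS ▸ hz)) hδ3
    filter_upwards [hε.eventually_lt_const hδ3, eventually_gt_atTop i] with n hn hin
    obtain ⟨w, hw, hiw⟩ := hAnet n i (Finset.mem_range.2 hin)
    refine ⟨w, hw, hball (Metric.mem_ball'.2 ?_)⟩
    calc dist z w ≤ dist z (testPair ω i).1 + dist (testPair ω i).1 w := dist_triangle _ _ _
      _ < δ := by linarith

theorem isSigmaTwo_of_isG1 (hΩ : Ω ⊆ ContinuousClass ω)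
    (hG1 : ∀ F ∈ Ω, IsG1 (koopman F ω)) : IsSigmaTwo ω Ω := by
  have := Measure.nonempty_of_neZero ω
  have hpos : ∀ n : ℕ, (0 : ℝ) < (1 / 2) ^ n := fun n => by positivity
  obtain ⟨Γ, hΓ, hlim⟩ := LimitSelectable.exists_algorithms fun n : ℕ =>
    limitSelectable_net_of_isG1 hΩ hG1 (hpos n) (hpos n) (Finset.range n)
  refine ⟨Γ, hΓ, fun F hF y hy => ?_⟩
  obtain ⟨G, hG⟩ := hlim F hF y hy
  obtain ⟨S, hS⟩ := exists_nonemptyCompacts_eq_approxPointSpectrum (hΩ hF)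
  have hGS : ∀ n, (G n : Set ℂ) ⊆ Metric.thickening ((1 / 2) ^ n) (S : Set ℂ) := fun n =>
    hS ▸ (hG n).1.1.trans (hG1 F hF _)
  refine ⟨S, G, hS, fun n => (hG n).2, tendsto_of_subset_thickening_of_net
    (tendsto_pow_atTop_nhds_zero_of_lt_one one_half_pos.le one_half_lt_one) hS hGS
    fun n => (hG n).1.2, fun n => (hGS n).trans ?_⟩
  rw [← add_ball_zero]
  exact Set.add_subset_add_left Metric.ball_subset_closedBall

end GrowthConditionLimits

section Classes

theorem isG1_koopman_of_measurePreserving {X : Type*} [MeasurableSpace X] {ω : Measure X}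
    {F : X → X} (hF : MeasurePreserving F ω ω) : IsG1 (koopman F ω) :=
  isG1_of_isometry (norm_koopman_of_measurePreserving hF)

theorem modulusClass_subset_continuousClass {X : Type*} [MetricSpace X] [MeasurableSpace X]
    {ω : Measure X} {α : ℝ≥0 → ℝ≥0}
    (hequi : UniformEquicontinuous ((↑) : ModulusClass ω α → X → X)) :
    ModulusClass ω α ⊆ ContinuousClass ω := fun F hF =>
  ⟨(hequi.uniformContinuous ⟨F, hF⟩).continuous, hF.2⟩

variable {X : Type*} [MetricSpace X] [MeasurableSpace X] (ω : Measure X)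

theorem uniformEquicontinuous_modulusClass {α : ℝ≥0 → ℝ≥0} (hα : Tendsto α (𝓝 0) (𝓝 0)) :
    UniformEquicontinuous ((↑) : ModulusClass ω α → X → X) := by
  refine Metric.uniformEquicontinuous_of_continuity_modulus (fun r => α r.toNNReal) ?_ _
    fun x y F => ?_
  · have htoNNReal : Tendsto Real.toNNReal (𝓝 0) (𝓝 0) := by
      simpa only [Real.toNNReal_zero] using continuous_real_toNNReal.tendsto 0
    exact NNReal.tendsto_coe.2 (hα.comp htoNNReal)
  · rw [← coe_nndist, ← coe_nndist, Real.toNNReal_coe]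
    exact F.2.1 x y

theorem measurePreservingClass_subset_continuousClass :
    MeasurePreservingClass ω ⊆ ContinuousClass ω := fun _ hF =>
  ⟨hF.1, hF.2.quasiMeasurePreserving, koopmanBounded_of_measurePreserving hF.2⟩

end Classes

end KoopmanSCI

theorem theorem2_general {X : Type*} [MetricSpace X] [CompactSpace X] [MeasurableSpace X]
    [BorelSpace X] (ω : Measure X) [IsFiniteMeasure ω] (hω : ω ≠ 0) {Ω : Set (X → X)}
    (hΩ : Ω ⊆ KoopmanSCI.ContinuousClass ω) :
    (UniformEquicontinuous ((↑) : Ω → X → X) → KoopmanSCI.IsPiTwo ω Ω) ∧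
    ((∀ F ∈ Ω, KoopmanSCI.IsG1 (KoopmanSCI.koopman F ω)) → KoopmanSCI.IsSigmaTwo ω Ω) ∧
    KoopmanSCI.IsPiThree ω Ω := by
  have : NeZero ω := ⟨hω⟩
  exact ⟨KoopmanSCI.isPiTwo_of_uniformEquicontinuous hΩ, KoopmanSCI.isSigmaTwo_of_isG1 hΩ,
    KoopmanSCI.isPiThree_of_subset_continuousClass hΩ⟩

theorem theorem2 {X : Type*} [MetricSpace X] [CompactSpace X] [MeasurableSpace X] [BorelSpace X]
    (ω : Measure X) [IsFiniteMeasure ω] (hω : ω ≠ 0) :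
    -- two limits, covering from above in the last limit, for a known modulus of continuity
    (∀ α : ℝ≥0 → ℝ≥0, Monotone α → Continuous α → α 0 = 0 →
      ∃ Γ : ℕ → ℕ → (X → ℕ → X) → NonemptyCompacts ℂ,
        (∀ n₂ n₁, KoopmanSCI.IsGeneralAlgorithm (KoopmanSCI.ModulusClass ω α) (Γ n₂ n₁)) ∧
        ∀ F ∈ KoopmanSCI.ModulusClass ω α, ∀ y, KoopmanSCI.IsSnapshotData F y →
          ∃ (S : NonemptyCompacts ℂ) (G : ℕ → NonemptyCompacts ℂ),
            (S : Set ℂ) = KoopmanSCI.approxPointSpectrum (KoopmanSCI.koopman F ω) ∧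
            (∀ n₂, Tendsto (fun n₁ => Γ n₂ n₁ y) atTop (𝓝 (G n₂))) ∧
            Tendsto G atTop (𝓝 S) ∧
            ∀ n₂, (S : Set ℂ) ⊆ (G n₂ : Set ℂ) + Metric.closedBall (0 : ℂ) ((1 / 2 : ℝ) ^ n₂)) ∧
    -- two limits, contained from below in the last limit, for measure-preserving maps
    (∃ Γ : ℕ → ℕ → (X → ℕ → X) → NonemptyCompacts ℂ,
        (∀ n₂ n₁, KoopmanSCI.IsGeneralAlgorithm (KoopmanSCI.MeasurePreservingClass ω)
          (Γ n₂ n₁)) ∧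
        ∀ F ∈ KoopmanSCI.MeasurePreservingClass ω, ∀ y, KoopmanSCI.IsSnapshotData F y →
          ∃ (S : NonemptyCompacts ℂ) (G : ℕ → NonemptyCompacts ℂ),
            (S : Set ℂ) = KoopmanSCI.approxPointSpectrum (KoopmanSCI.koopman F ω) ∧
            (∀ n₂, Tendsto (fun n₁ => Γ n₂ n₁ y) atTop (𝓝 (G n₂))) ∧
            Tendsto G atTop (𝓝 S) ∧
            ∀ n₂, (G n₂ : Set ℂ) ⊆ (S : Set ℂ) + Metric.closedBall (0 : ℂ) ((1 / 2 : ℝ) ^ n₂)) ∧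
    -- three limits, covering from above in the last limit, for general continuous maps
    (∃ Γ : ℕ → ℕ → ℕ → (X → ℕ → X) → NonemptyCompacts ℂ,
        (∀ n₃ n₂ n₁, KoopmanSCI.IsGeneralAlgorithm (KoopmanSCI.ContinuousClass ω)
          (Γ n₃ n₂ n₁)) ∧
        ∀ F ∈ KoopmanSCI.ContinuousClass ω, ∀ y, KoopmanSCI.IsSnapshotData F y →
          ∃ (S : NonemptyCompacts ℂ) (G : ℕ → NonemptyCompacts ℂ)
            (G' : ℕ → ℕ → NonemptyCompacts ℂ),
            (S : Set ℂ) = KoopmanSCI.approxPointSpectrum (KoopmanSCI.koopman F ω) ∧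
            (∀ n₃ n₂, Tendsto (fun n₁ => Γ n₃ n₂ n₁ y) atTop (𝓝 (G' n₃ n₂))) ∧
            (∀ n₃, Tendsto (fun n₂ => G' n₃ n₂) atTop (𝓝 (G n₃))) ∧
            Tendsto G atTop (𝓝 S) ∧
            ∀ n₃, (S : Set ℂ) ⊆ (G n₃ : Set ℂ) + Metric.closedBall (0 : ℂ) ((1 / 2 : ℝ) ^ n₃)) := by
  refine ⟨fun α _ hα hα0 => ?_, ?_, (theorem2_general ω hω subset_rfl).2.2⟩
  · have hequi := KoopmanSCI.uniformEquicontinuous_modulusClass ω (hα.tendsto' 0 0 hα0)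
    exact (theorem2_general ω hω (KoopmanSCI.modulusClass_subset_continuousClass hequi)).1 hequi
  · exact (theorem2_general ω hω
      (KoopmanSCI.measurePreservingClass_subset_continuousClass ω)).2.1
        fun F hF => KoopmanSCI.isG1_koopman_of_measurePreserving hF.2
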